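/- Let $d,m\ge 0$ be integers and let $L:\mathbb{C}^d\times\mathbb{C}^d\to\mathbb{C}$ be a bilinear function. For $\mathbf A=(\mathbf a_1,\dots,\mathbf a_m)\in(\mathbb{C}^d)^m$ and $\mathbf x\in\mathbb{C}^d$ put $L_{\mathbf A}(\mathbf x)=(L(\mathbf a_1,\mathbf x),\dots,L(\mathbf a_m,\mathbf x))\in\mathbb{C}^m$. An algebraic variety in $\mathbb{C}^n$ is the common zero locus of finitely many polynomials in $\mathbb{C}[x_1,\dots,x_n]$, not necessarily irreducible, and a real algebraic subset of $\mathbb{R}^n$ is the common zero locus of finitely many polynomials in $\mathbb{R}[x_1,\dots,x_n]$. For $S\subset\mathbb{C}^n$, $\dim S$ denotes the Krull dimension of $\mathbb{C}[x_1,\dots,x_n]/I(S)$, where $I(S)$ is the ideal of the polynomials vanishing on $S$; for $S\subset\mathbb{R}^n$, $\dim_{\mathbb{R}}S$ is the Krull dimension of $\mathbb{R}[x_1,\dots,x_n]/I(S)$, with $I(S)$ formed in $\mathbb{R}[x_1,\dots,x_n]$. The empty set has dimension $-\infty$. For $S\subset\mathbb{C}^n$ put $S_{\mathbb{R}}=S\cap\mathbb{R}^n$.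 Let $W\subset\mathbb{C}^d$ be the common zero locus of finitely many homogeneous polynomials, and let $V_1,\dots,V_m\subset\mathbb{C}^d$ be nonempty algebraic varieties. Assume that each $V_j$ is admissible with respect to the linear functions $L(\cdot,\mathbf x)$, $\mathbf x\in W\setminus\{0\}$, that is, $$\dim\bigl(V_j\cap\{\mathbf a\in\mathbb{C}^d: L(\mathbf a,\mathbf x)=0\}\bigr)<\dim V_j\qquad\text{for every } \mathbf x\in W\setminus\{0\}.$$ Let $V=V_1\times\cdots\times V_m\subset(\mathbb{C}^d)^m$ and suppose that $\dim_{\mathbb{R}}(V_{\mathbb{R}})=\dim V$ and $m\ge\dim W$. Then there is a real algebraic subset $\tilde Z\subset V_{\mathbb{R}}$ with $\dim_{\mathbb{R}}\tilde Z<\dim_{\mathbb{R}}V_{\mathbb{R}}$ such that, for every $\mathbf A\in V_{\mathbb{R}}\setminus\tilde Z$ and every $\mathbf x\in W$, $L_{\mathbf A}(\mathbf x)=0$ implies $\mathbf x=0$. -/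

import Mathlib

noncomputable section

namespace OptimalSampling

/-- A subset of `k^σ` is algebraic if it is the common zero locus of finitely many polynomials
over `k`. -/
def IsAlgebraicSet {k σ : Type*} [Field k] (S : Set (σ → k)) : Prop :=
  ∃ P : Finset (MvPolynomial σ k), S = {x | ∀ p ∈ P, MvPolynomial.eval x p = 0}

/-- A subset of `k^σ` that is the common zero locus of finitely many homogeneous polynomials
over `k` (possibly of different degrees). -/
def IsHomogeneousAlgebraicSet {k σ : Type*} [Field k] (S : Set (σ → k)) : Prop :=
  ∃ P : Finset (MvPolynomial σ k), (∀ p ∈ P, ∃ n : ℕ, p.IsHomogeneous n) ∧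
    S = {x | ∀ p ∈ P, MvPolynomial.eval x p = 0}

/-- The dimension of `S ⊆ k^σ`: the Krull dimension of the ring `k[x] / I(S)` of polynomial
functions on `S`, where `I(S)` is the ideal of all polynomials over `k` vanishing on `S`.
For `k = ℂ` this is the dimension of an algebraic variety, for `k = ℝ` it is the real
dimension of a real algebraic set. The empty set has dimension `⊥`. -/
def dim {k σ : Type*} [Field k] (S : Set (σ → k)) : WithBot ℕ∞ :=
  ringKrullDim (MvPolynomial σ k ⧸ MvPolynomial.vanishingIdeal k S)

/-- The real points `S_ℝ = S ∩ ℝ^σ` of `S ⊆ ℂ^σ`, as a subset of `ℝ^σ`. -/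
def realPoints {σ : Type*} (S : Set (σ → ℂ)) : Set (σ → ℝ) :=
  {a | (fun i => (a i : ℂ)) ∈ S}

/-- `V` is admissible with respect to a set `F` of linear functions if every hyperplane section
`V ∩ {ℓ = 0}` with `ℓ ∈ F` has strictly smaller dimension than `V`. -/
def IsAdmissible {d : ℕ} (V : Set (Fin d → ℂ)) (F : Set ((Fin d → ℂ) →ₗ[ℂ] ℂ)) : Prop :=
  ∀ ℓ ∈ F, dim (V ∩ {a | ℓ a = 0}) < dim V

/-- The product `V₁ × ⋯ × V_m ⊆ (ℂ^d)^m`; the `j`-th vector of `A` is `i ↦ A (j, i)`. -/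
def productSet {m d : ℕ} (V : Fin m → Set (Fin d → ℂ)) : Set (Fin m × Fin d → ℂ) :=
  {A | ∀ j, (fun i => A (j, i)) ∈ V j}

/-- The sampling map `L_A(x) = (L(a₁, x), …, L(a_m, x))`. -/
def sample {m d : ℕ} (L : (Fin d → ℂ) →ₗ[ℂ] (Fin d → ℂ) →ₗ[ℂ] ℂ) (A : Fin m × Fin d → ℂ)
    (x : Fin d → ℂ) : Fin m → ℂ :=
  fun j => L (fun i => A (j, i)) x

end OptimalSampling

end

/-! The real statement follows from a complex one: the bad `A` lie in an algebraic subset `Z` of `V`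
of smaller dimension. Passing to real points does not raise the dimension (`dim_realPoints_le`), so
`dim V_ℝ = dim V` gives the real bound.

For the complex statement, split `V` into products `K` of irreducible components of the `V j`. Each
`K` is irreducible, and dimensions add up (`dim_productSet`), so `K` has full dimension only if all
its factors do. By admissibility a full-dimensional factor lies in no hyperplane `L(·, x) = 0` with
`x ∈ W \ {0}`. Hence points `a j` can be chosen one at a time, each lowering the bound on `dim W` by
one (`exists_dim_inter_le`). As `m ≥ dim W`, nothing but `0` survives, because a cone with a nonzero
point has dimension at least `1`. So every full-dimensional `K` contains a good point. Goodness is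
an open condition (`exists_eval_ne_zero`): some polynomial is nonzero at that point and nonzero only
at good points, and its zeros cut the irreducible `K` in smaller dimension. -/

noncomputable section

namespace OptimalSampling

open MvPolynomial

/-! ### Krull dimension under integral ring maps -/

section Integral

variable {R S : Type*} [CommRing R] [CommRing S]

/-- Incomparability: strict inclusions of primes survive contraction. -/
lemma ringKrullDim_le_of_isIntegral (f : R →+* S) (hf : f.IsIntegral) :
    ringKrullDim S ≤ ringKrullDim R := by
  algebraize [f]
  refine Order.krullDim_le_of_strictMono (PrimeSpectrum.comap f) fun P Q h => ?_
  have : P.asIdeal < Q.asIdeal := h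
  exact Ideal.IsIntegral.comap_lt_comap (R := R) this

/-- Lying over and going up lift every chain of primes. Dimensions of products and of real points
are computed this way. -/
lemma ringKrullDim_eq_of_isIntegral (f : R →+* S) (hf : f.IsIntegral)
    (hinj : Function.Injective f) : ringKrullDim R = ringKrullDim S := by
  refine le_antisymm ?_ (ringKrullDim_le_of_isIntegral f hf)
  algebraize [f]
  have : FaithfulSMul R S := (faithfulSMul_iff_algebraMap_injective R S).2 hinj
  refine iSup_le fun l => ?_
  obtain ⟨Q, hQ⟩ := (RingHom.IsIntegral.comap_surjective hf hinj) l.head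
  have : Q.asIdeal.LiesOver l.head.asIdeal := ⟨by rw [← hQ]; rfl⟩
  obtain ⟨L, hL, -⟩ := Ideal.exists_ltSeries_of_hasGoingUp l Q.asIdeal
  rw [← hL]
  exact Order.LTSeries.length_le_krullDim L

end Integral

/-! ### Dimension and irreducible decomposition -/

section Dim

variable {k σ : Type*} [Field k]

lemma dim_mono {S T : Set (σ → k)} (h : S ⊆ T) : dim S ≤ dim T :=
  ringKrullDim_le_of_surjective (Ideal.Quotient.factor (vanishingIdeal_anti_mono h))
    (Ideal.Quotient.factor_surjective _)

lemma vanishingIdeal_ne_top {S : Set (σ → k)} (h : S.Nonempty) : vanishingIdeal k S ≠ ⊤ := by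
  obtain ⟨x, hx⟩ := h
  rw [Ne, Ideal.eq_top_iff_one]
  intro h1
  simpa using h1 x hx

lemma dim_nonneg {S : Set (σ → k)} (h : S.Nonempty) : 0 ≤ dim S := by
  have := Ideal.Quotient.nontrivial_iff.2 (vanishingIdeal_ne_top h)
  exact ringKrullDim_nonneg_of_nontrivial

lemma dim_empty : dim (∅ : Set (σ → k)) = ⊥ := by
  have : Subsingleton (MvPolynomial σ k ⧸ vanishingIdeal k (∅ : Set (σ → k))) :=
    Ideal.Quotient.subsingleton_iff.2 vanishingIdeal_empty
  exact ringKrullDim_eq_bot_of_subsingleton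

lemma dim_le_card [Finite σ] (S : Set (σ → k)) : dim S ≤ Nat.card σ := by
  refine (ringKrullDim_quotient_le _).trans ?_
  simp

lemma exists_dim_eq_natCast [Finite σ] {S : Set (σ → k)} (h : S.Nonempty) :
    ∃ n : ℕ, dim S = n := by
  have h0 := dim_nonneg h
  have h1 := dim_le_card S
  generalize dim S = a at h0 h1
  induction a with
  | bot => simp at h0
  | coe a =>
    induction a with
    | top => exact absurd h1 (not_le.2 (WithBot.coe_lt_coe.2 (ENat.natCast_lt_top (Nat.card σ))))
    | coe n => exact ⟨n, rfl⟩

/-- The dimension of a finite union is at most the dimension of one of its members. -/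
lemma exists_dim_iUnion_le {ι : Type*} [Finite ι] [Nonempty ι] (S : ι → Set (σ → k)) :
    ∃ i, dim (⋃ i, S i) ≤ dim (S i) := by
  obtain ⟨i₀, hi₀⟩ := Finite.exists_max fun i => dim (S i)
  refine ⟨i₀, ?_⟩
  have := Fintype.ofFinite ι
  rw [dim, ringKrullDim_quotient]
  refine iSup_le fun l => ?_
  -- The smallest prime of the chain contains a finite intersection of ideals, hence one of them,
  -- and the whole chain lies above that one.
  obtain ⟨i, hi⟩ : ∃ i, vanishingIdeal k (S i) ≤ l.head.1.asIdeal := by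
    have h : Finset.univ.inf (fun i => vanishingIdeal k (S i)) ≤ l.head.1.asIdeal := by
      refine le_trans (fun p hp => ?_) l.head.2
      intro x hx
      obtain ⟨i, hi⟩ := Set.mem_iUnion.1 hx
      exact (Submodule.mem_finsetInf.1 hp) i (Finset.mem_univ _) x hi
    obtain ⟨i, -, hi⟩ := (Ideal.IsPrime.inf_le' l.head.1.2).1 h
    exact ⟨i, hi⟩
  refine le_trans ?_ (hi₀ i)
  rw [dim, ringKrullDim_quotient]
  let L : LTSeries (PrimeSpectrum.zeroLocus (vanishingIdeal k (S i) : Set (MvPolynomial σ k))) :=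
    { length := l.length
      toFun := fun j => ⟨(l j).1, hi.trans (show l.head.1 ≤ (l j).1 from l.head_le j)⟩
      step := fun j => l.step j }
  exact Order.LTSeries.length_le_krullDim L

lemma dim_iUnion_le {ι : Type*} [Finite ι] {S : ι → Set (σ → k)} {n : WithBot ℕ∞}
    (h : ∀ i, dim (S i) ≤ n) : dim (⋃ i, S i) ≤ n := by
  cases isEmpty_or_nonempty ι
  · simp [dim_empty]
  · obtain ⟨i, hi⟩ := exists_dim_iUnion_le S
    exact hi.trans (h i)

/-- A subset of an irreducible set on which a further polynomial vanishes has smaller dimension. -/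
lemma dim_add_one_le {S C : Set (σ → k)} (hC : (vanishingIdeal k C).IsPrime) (h : S ⊆ C)
    {f : MvPolynomial σ k} (hS : f ∈ vanishingIdeal k S) (hf : f ∉ vanishingIdeal k C) :
    dim S + 1 ≤ dim C := by
  refine ringKrullDim_succ_le_of_surjective (Ideal.Quotient.factor (vanishingIdeal_anti_mono h))
    (Ideal.Quotient.factor_surjective _) (r := Ideal.Quotient.mk _ f) ?_ ?_
  · rw [mem_nonZeroDivisors_iff_ne_zero, Ne, Ideal.Quotient.eq_zero_iff_mem]
    exact hf
  · simpa [Ideal.Quotient.eq_zero_iff_mem] using hS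

/-- Strictness rests on finiteness of the dimension; empty `S` is separate because `⊥ + 1 = ⊥`. -/
lemma dim_lt_of_add_one_le [Finite σ] {S C : Set (σ → k)} (hC : C.Nonempty)
    (h : dim S + 1 ≤ dim C) : dim S < dim C := by
  obtain ⟨n, hn⟩ := exists_dim_eq_natCast hC
  rcases S.eq_empty_or_nonempty with rfl | hS
  · rw [dim_empty, hn]; exact WithBot.bot_lt_coe _
  · obtain ⟨s, hs⟩ := exists_dim_eq_natCast hS
    rw [hs, hn] at h ⊢
    norm_cast at h ⊢

lemma nonempty_of_isPrime {C : Set (σ → k)} (hC : (vanishingIdeal k C).IsPrime) : C.Nonempty := by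
  rw [Set.nonempty_iff_ne_empty]
  rintro rfl
  exact hC.ne_top vanishingIdeal_empty

/-- An algebraic set over an algebraically closed field is a finite union of irreducible ones. -/
lemma IsAlgebraicSet.exists_iUnion_eq [IsAlgClosed k] [Finite σ] {S : Set (σ → k)}
    (hS : IsAlgebraicSet S) :
    ∃ (n : ℕ) (C : Fin n → Set (σ → k)),
      (∀ i, (vanishingIdeal k (C i)).IsPrime) ∧ S = ⋃ i, C i := by
  obtain ⟨P, rfl⟩ := hS
  let I : Ideal (MvPolynomial σ k) := Ideal.span P
  have hfin : Finite I.minimalPrimes := Ideal.finite_minimalPrimes_of_isNoetherianRing _ I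
  obtain ⟨n, ⟨e⟩⟩ := Finite.exists_equiv_fin I.minimalPrimes
  refine ⟨n, fun i => zeroLocus k (e.symm i).1, fun i => ?_, ?_⟩
  · have := (e.symm i).2.1.1
    -- Nullstellensatz: a prime ideal is recovered from its zero locus.
    rw [IsPrime.vanishingIdeal_zeroLocus]
    exact this
  · ext x
    simp only [Set.mem_iUnion, Set.mem_ofPred_eq]
    constructor
    · intro hx
      have hle : I ≤ vanishingIdeal k {x} := by
        rw [Ideal.span_le]
        rintro p hp y rfl
        simpa [aeval_eq_eval] using hx p hp
      have hprime : (vanishingIdeal k {x}).IsPrime :=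
        (isMaximal_iff_eq_vanishingIdeal_singleton.2 ⟨x, rfl⟩).isPrime
      obtain ⟨Q, hQ, hQx⟩ := Ideal.exists_minimalPrimes_le hle
      refine ⟨e ⟨Q, hQ⟩, ?_⟩
      rw [Equiv.symm_apply_apply]
      exact fun p hp => hQx hp x rfl
    · rintro ⟨i, hi⟩ p hp
      have := hi p ((e.symm i).2.1.2 (Ideal.subset_span hp))
      simpa [aeval_eq_eval] using this

end Dim

/-! ### Polynomials restricted to a block of coordinates -/

section Slice

variable {k σ τ : Type*} [Field k]

/-- The polynomial `z ↦ F (y with the coordinates in the range of e replaced by z)`. -/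
def slice (e : σ → τ) (y : τ → k) (F : MvPolynomial τ k) : MvPolynomial σ k :=
  aeval (Function.extend e X fun t => C (y t)) F

lemma eval_slice (e : σ → τ) (y : τ → k) (F : MvPolynomial τ k) (z : σ → k) :
    eval z (slice e y F) = eval (Function.extend e z y) F := by
  rw [slice, ← aeval_eq_eval, ← AlgHom.comp_apply, comp_aeval, ← aeval_eq_eval]
  congr 2
  funext t
  rw [Function.apply_extend (aeval z)]
  congr 1 <;> funext s <;> simp

/-- A polynomial that vanishes on a product of Zariski dense sets is zero. -/
lemma eq_zero_of_eval_eq_zero_of_dense [Infinite k] {ι : Type*} [Finite ι] {s : ι → ℕ}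
    (E : ∀ j, Set (Fin (s j) → k)) (hE : ∀ j, vanishingIdeal k (E j) = ⊥)
    (F : MvPolynomial (Σ j, Fin (s j)) k)
    (hF : ∀ y : (Σ j, Fin (s j)) → k, (∀ j, (fun i => y ⟨j, i⟩) ∈ E j) → eval y F = 0) :
    F = 0 := by
  classical
  have := Fintype.ofFinite ι
  -- `T` collects the blocks freed from the constraint `E j`. A further block can be freed because
  -- the slice in it vanishes on the dense set `E j`.
  have key : ∀ T : Finset ι, ∀ y : (Σ j, Fin (s j)) → k,
      (∀ j ∉ T, (fun i => y ⟨j, i⟩) ∈ E j) → eval y F = 0 := by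
    intro T
    induction T using Finset.induction with
    | empty => exact fun y hy => hF y fun j => hy j (by simp)
    | insert j T hj ih =>
      intro y hy
      have hinj : Function.Injective (fun i : Fin (s j) => (⟨j, i⟩ : Σ j, Fin (s j))) := by
        intro a b h
        cases h
        rfl
      have h0 : slice (Sigma.mk j) y F = 0 := by
        rw [← Ideal.mem_bot, ← hE j]
        intro z hz
        rw [aeval_eq_eval, eval_slice]
        refine ih _ fun j' hj' => ?_
        by_cases hjj : j' = j
        · subst hjj
          simpa [hinj.extend_apply] using hz
        · convert! hy j' (by simp [hjj, hj']) using 2 with i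
          exact Function.extend_apply' _ _ _ (by rintro ⟨a, ha⟩; exact hjj (congrArg Sigma.fst ha).symm)
      have h1 := eval_slice (Sigma.mk j) y F (fun i => y ⟨j, i⟩)
      rw [h0, map_zero] at h1
      rw [h1]
      congr 2
      funext t
      by_cases ht : ∃ i, Sigma.mk j i = t
      · obtain ⟨i, rfl⟩ := ht
        rw [hinj.extend_apply]
      · rw [Function.extend_apply' _ _ _ ht]
  exact MvPolynomial.funext fun y => by
    rw [key Finset.univ y (by simp), map_zero]

end Slice

/-! ### Irreducibility and dimension of products -/

section Product

variable {m d : ℕ}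

lemma prodMk_injective (j : Fin m) : Function.Injective (Prod.mk j : Fin d → Fin m × Fin d) :=
  fun _ _ h => (Prod.ext_iff.1 h).2

lemma extend_mem_productSet {C : Fin m → Set (Fin d → ℂ)} {A : Fin m × Fin d → ℂ}
    (hA : A ∈ productSet C) {j : Fin m} {z : Fin d → ℂ} (hz : z ∈ C j) :
    Function.extend (Prod.mk j) z A ∈ productSet C := by
  intro j'
  by_cases hjj : j' = j
  · subst hjj
    simpa [(prodMk_injective j').extend_apply] using hz
  · convert! hA j' using 2 with i
    exact Function.extend_apply' _ _ _ (by rintro ⟨a, ha⟩; exact hjj (congrArg Prod.fst ha).symm)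

lemma extend_apply_of_ne {A : Fin m × Fin d → ℂ} {j j' : Fin m} (h : j' ≠ j) (z : Fin d → ℂ)
    (i : Fin d) : Function.extend (Prod.mk j) z A (j', i) = A (j', i) :=
  Function.extend_apply' _ _ _ (by rintro ⟨a, ha⟩; exact h (congrArg Prod.fst ha).symm)

lemma extend_self (A : Fin m × Fin d → ℂ) (j : Fin m) :
    Function.extend (Prod.mk j) (fun i => A (j, i)) A = A := by
  funext t
  by_cases ht : ∃ i, Prod.mk j i = t
  · obtain ⟨i, rfl⟩ := ht
    rw [(prodMk_injective j).extend_apply]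
  · rw [Function.extend_apply' _ _ _ ht]

lemma productSet_nonempty {C : Fin m → Set (Fin d → ℂ)} (h : ∀ j, (C j).Nonempty) :
    (productSet C).Nonempty := by
  choose a ha using h
  exact ⟨fun p => a p.1 p.2, fun j => ha j⟩

/-- A product of irreducible sets is irreducible. -/
lemma isPrime_vanishingIdeal_productSet {C : Fin m → Set (Fin d → ℂ)}
    (hC : ∀ j, (vanishingIdeal ℂ (C j)).IsPrime) :
    (vanishingIdeal ℂ (productSet C)).IsPrime := by
  refine Ideal.isPrime_iff.2 ⟨vanishingIdeal_ne_top
    (productSet_nonempty fun j => nonempty_of_isPrime (hC j)), fun {f g} hfg => ?_⟩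
  by_contra! hcon
  obtain ⟨hf, hg⟩ := hcon
  -- `T` collects the blocks where the two witnesses agree. In a new block neither slice vanishes on
  -- `C j`, so by primeness one `z` serves both. Once all blocks agree, `f * g` is nonzero at a
  -- point of the product.
  have key : ∀ T : Finset (Fin m), ∃ a ∈ productSet C, ∃ b ∈ productSet C,
      eval a f ≠ 0 ∧ eval b g ≠ 0 ∧ ∀ j ∈ T, ∀ i, a (j, i) = b (j, i) := by
    intro T
    induction T using Finset.induction with
    | empty =>
      simp only [mem_vanishingIdeal_iff, not_forall, aeval_eq_eval] at hf hg
      obtain ⟨a, ha, haf⟩ := hf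
      obtain ⟨b, hb, hbg⟩ := hg
      exact ⟨a, ha, b, hb, haf, hbg, by simp⟩
    | insert j T hj ih =>
      obtain ⟨a, ha, b, hb, haf, hbg, hab⟩ := ih
      have h1 : slice (Prod.mk j) a f ∉ vanishingIdeal ℂ (C j) := fun h => haf <| by
        have := h _ (ha j)
        rwa [aeval_eq_eval, eval_slice, extend_self] at this
      have h2 : slice (Prod.mk j) b g ∉ vanishingIdeal ℂ (C j) := fun h => hbg <| by
        have := h _ (hb j)
        rwa [aeval_eq_eval, eval_slice, extend_self] at this
      have h3 := fun h => ((hC j).mem_or_mem h).elim h1 h2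
      simp only [mem_vanishingIdeal_iff, not_forall, aeval_eq_eval, imp_false, map_mul,
        eval_slice, mul_eq_zero, not_or] at h3
      obtain ⟨z, hz, hzf, hzg⟩ := h3
      refine ⟨_, extend_mem_productSet ha hz, _, extend_mem_productSet hb hz, hzf, hzg, ?_⟩
      intro j' hj' i
      by_cases hjj : j' = j
      · subst hjj
        rw [(prodMk_injective j').extend_apply, (prodMk_injective j').extend_apply]
      · rw [extend_apply_of_ne hjj, extend_apply_of_ne hjj]
        exact hab j' (Finset.mem_of_mem_insert_of_ne hj' hjj) i
  obtain ⟨a, ha, b, hb, haf, hbg, hab⟩ := key Finset.univ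
  obtain rfl : a = b := funext fun p => hab p.1 (Finset.mem_univ _) p.2
  have := hfg a ha
  rw [map_mul, aeval_eq_eval, mul_eq_zero] at this
  exact this.elim haf hbg

/-- The dimension of a product of nonempty sets is the sum of the dimensions. -/
lemma dim_productSet {C : Fin m → Set (Fin d → ℂ)} (hC : ∀ j, (C j).Nonempty) (s : Fin m → ℕ)
    (hs : ∀ j, dim (C j) = s j) : dim (productSet C) = (∑ j, s j : ℕ) := by
  -- Noether normalization of each factor; the dimension forces the number of variables to be `s j`.
  -- Together the normalizations yield one of the product.
  have hN : ∀ j, ∃ g : MvPolynomial (Fin (s j)) ℂ →ₐ[ℂ]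
      MvPolynomial (Fin d) ℂ ⧸ vanishingIdeal ℂ (C j), Function.Injective g ∧ g.IsIntegral := by
    intro j
    obtain ⟨t, -, g, hg, hi⟩ :=
      exists_integral_inj_algHom_of_quotient (vanishingIdeal ℂ (C j)) (vanishingIdeal_ne_top (hC j))
    have h1 := ringKrullDim_eq_of_isIntegral g.toRingHom hi hg
    have h2 := hs j
    rw [dim, ← h1] at h2
    simp only [MvPolynomial.ringKrullDim_of_isNoetherianRing, ringKrullDim_eq_zero_of_field,
      zero_add, Nat.card_fin] at h2
    obtain rfl : t = s j := by exact_mod_cast h2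
    exact ⟨g, hg, hi⟩
  choose g hg hi using hN
  choose G hG using fun j i => Ideal.Quotient.mk_surjective (g j (X i))
  have hgG : ∀ j F, g j F = Ideal.Quotient.mk _ (bind₁ (G j) F) := by
    intro j F
    have : g j = (Ideal.Quotient.mkₐ ℂ (vanishingIdeal ℂ (C j))).comp (bind₁ (G j)) := by
      ext i
      simp [hG]
    rw [this]; rfl
  let Q := MvPolynomial (Fin m × Fin d) ℂ ⧸ vanishingIdeal ℂ (productSet C)
  let γ : MvPolynomial (Σ j, Fin (s j)) ℂ →ₐ[ℂ] Q :=
    (Ideal.Quotient.mkₐ ℂ (vanishingIdeal ℂ (productSet C))).comp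
      (bind₁ fun p => rename (Prod.mk p.1) (G p.1 p.2))
  let φ : ∀ j, (MvPolynomial (Fin d) ℂ ⧸ vanishingIdeal ℂ (C j)) →ₐ[ℂ] Q := fun j =>
    Ideal.quotientMapₐ _ (rename (Prod.mk j)) (by
      intro p hp A hA
      rw [aeval_rename]
      exact hp _ (hA j))
  have hφmk : ∀ j p, φ j (Ideal.Quotient.mk _ p) =
      Ideal.Quotient.mk (vanishingIdeal ℂ (productSet C)) (rename (Prod.mk j) p) :=
    fun j p => rfl
  have hφ : ∀ j, (φ j).comp (g j) = γ.comp (rename (Sigma.mk j)) := by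
    intro j
    ext i
    simp [γ, ← hG, Q, hφmk]
  have hinj : Function.Injective γ := by
    rw [injective_iff_map_eq_zero]
    intro F hF
    -- The lifted coordinates `G j` map `C j` onto a dense set because `g j` is injective.
    refine eq_zero_of_eval_eq_zero_of_dense (fun j => (fun a i => eval a (G j i)) '' C j)
      (fun j => ?_) F fun y hy => ?_
    · rw [eq_bot_iff]
      intro H hH
      refine hg j ?_
      rw [map_zero, hgG, Ideal.Quotient.eq_zero_iff_mem]
      intro a ha
      have := hH _ ⟨a, ha, rfl⟩
      rw [aeval_bind₁]
      simpa [aeval_eq_eval] using this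
    · choose a ha hay using hy
      have h1 : bind₁ (fun p : Σ j, Fin (s j) => rename (Prod.mk p.1) (G p.1 p.2)) F ∈
          vanishingIdeal ℂ (productSet C) := Ideal.Quotient.eq_zero_iff_mem.1 hF
      have h2 := h1 (fun p => a p.1 p.2) (fun j => ha j)
      rw [aeval_bind₁] at h2
      rw [← aeval_eq_eval]
      convert h2 using 3
      funext p
      rw [aeval_rename, ← congrFun (hay p.1) p.2, aeval_eq_eval]
      rfl
  have hint : γ.toRingHom.IsIntegral := by
    intro q
    obtain ⟨p, rfl⟩ := Ideal.Quotient.mk_surjective q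
    induction p using MvPolynomial.induction_on with
    | C c =>
      have : (Ideal.Quotient.mk (vanishingIdeal ℂ (productSet C)) (MvPolynomial.C c)) =
          γ.toRingHom (MvPolynomial.C c) := (γ.commutes c).symm
      rw [this]
      exact RingHom.isIntegralElem_map _
    | add p q hp hq => rw [map_add]; exact hp.add _ hq
    | mul_X p t hp =>
      rw [map_mul]
      refine hp.mul _ ?_
      obtain ⟨j, i⟩ := t
      -- The monic equation of `X i` in factor `j` is transported to `X (j, i)` along `φ j`.
      obtain ⟨r, hr, hr0⟩ := hi j (Ideal.Quotient.mk _ (X i))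
      refine ⟨r.map (rename (Sigma.mk j)).toRingHom, hr.map _, ?_⟩
      have h1 : (Ideal.Quotient.mk (vanishingIdeal ℂ (productSet C)) (X (j, i))) =
          φ j (Ideal.Quotient.mk _ (X i)) := by simp [hφmk]
      rw [h1, Polynomial.eval₂_map]
      have h2 : γ.toRingHom.comp (rename (Sigma.mk j)).toRingHom =
          (φ j).toRingHom.comp (g j).toRingHom := by
        have := congrArg AlgHom.toRingHom (hφ j)
        exact this.symm
      rw [h2]
      have h3 := Polynomial.hom_eval₂ r (g j).toRingHom (φ j).toRingHom (Ideal.Quotient.mk _ (X i))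
      refine h3.symm.trans ?_
      erw [hr0]
      simp
  have := ringKrullDim_eq_of_isIntegral γ.toRingHom hint hinj
  rw [dim, ← this]
  simp [ringKrullDim_eq_zero_of_field]

end Product

/-! ### Linear functions as polynomials -/

section LinearForm

variable {d : ℕ}

/-- A linear function on `ℂ^d` as a polynomial. -/
def linearForm (ℓ : (Fin d → ℂ) →ₗ[ℂ] ℂ) : MvPolynomial (Fin d) ℂ :=
  ∑ i, C (ℓ (Pi.single i 1)) * X i

lemma eval_linearForm (ℓ : (Fin d → ℂ) →ₗ[ℂ] ℂ) (x : Fin d → ℂ) :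
    eval x (linearForm ℓ) = ℓ x := by
  conv_rhs => rw [LinearMap.pi_apply_eq_sum_univ ℓ x]
  simp only [linearForm, map_sum, map_mul, eval_C, eval_X, smul_eq_mul]
  refine Finset.sum_congr rfl fun i _ => ?_
  rw [mul_comm]
  congr 3
  funext j
  simp [Pi.single_apply, eq_comm]

lemma isHomogeneous_linearForm (ℓ : (Fin d → ℂ) →ₗ[ℂ] ℂ) : (linearForm ℓ).IsHomogeneous 1 :=
  IsHomogeneous.sum _ _ _ fun i _ => isHomogeneous_C_mul_X _ i

end LinearForm

/-! ### Cutting a cone by hyperplanes -/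

section Cone

variable {d : ℕ} {W : Set (Fin d → ℂ)}

lemma IsHomogeneousAlgebraicSet.isAlgebraicSet (hW : IsHomogeneousAlgebraicSet W) :
    IsAlgebraicSet W :=
  hW.imp fun _ h => h.2

lemma eval_mul_of_isHomogeneous {p : MvPolynomial (Fin d) ℂ} {n : ℕ} (hp : p.IsHomogeneous n)
    (x : Fin d → ℂ) (t : ℂ) : eval (fun i => x i * t) p = eval x p * t ^ n := by
  rw [eval_eq', eval_eq', Finset.sum_mul]
  refine Finset.sum_congr rfl fun μ hμ => ?_
  have h1 : ∑ i, μ i = n := by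
    have := hp (mem_support_iff.1 hμ)
    rwa [Finsupp.weight_apply, Finsupp.sum_fintype _ _ (by simp), Finset.sum_congr rfl] at this
    simp
  simp only [mul_pow, Finset.prod_mul_distrib, Finset.prod_pow_eq_pow_sum, h1, mul_assoc]

lemma IsHomogeneousAlgebraicSet.mul_mem (hW : IsHomogeneousAlgebraicSet W)
    {x : Fin d → ℂ} (hx : x ∈ W) (t : ℂ) : (fun i => x i * t) ∈ W := by
  obtain ⟨P, hP, rfl⟩ := hW
  intro p hp
  obtain ⟨n, hn⟩ := hP p hp
  rw [eval_mul_of_isHomogeneous hn, hx p hp, zero_mul]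

/-- A homogeneous algebraic set with a nonzero point contains a line. -/
lemma IsHomogeneousAlgebraicSet.one_le_dim (hW : IsHomogeneousAlgebraicSet W)
    {x : Fin d → ℂ} (hx : x ∈ W) (hx0 : x ≠ 0) : 1 ≤ dim W := by
  -- Restriction to the line through `x`, which is onto since some coordinate of `x` is nonzero.
  let ψ : MvPolynomial (Fin d) ℂ →ₐ[ℂ] Polynomial ℂ :=
    aeval fun i => Polynomial.C (x i) * Polynomial.X
  have hψ : ∀ p ∈ vanishingIdeal ℂ W, ψ p = 0 := by
    intro p hp
    refine Polynomial.funext fun t => ?_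
    have h1 : (Polynomial.aeval t).comp ψ = aeval fun i => x i * t := by
      ext i
      simp [ψ]
    have h2 := DFunLike.congr_fun h1 p
    rw [hp _ (hW.mul_mem hx t)] at h2
    simpa using h2
  have hsurj : Function.Surjective ψ := by
    obtain ⟨i, hi⟩ := Function.ne_iff.1 hx0
    have hi : x i ≠ 0 := hi
    intro q
    refine ⟨Polynomial.aeval (C (x i)⁻¹ * X i) q, ?_⟩
    rw [← AlgHom.comp_apply]
    have : ψ.comp (Polynomial.aeval (C (x i)⁻¹ * X i)) = AlgHom.id ℂ _ := by
      ext
      simp only [AlgHom.comp_apply, Polynomial.aeval_X, map_mul, ψ, aeval_C, aeval_X,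
        Polynomial.algebraMap_eq, ← mul_assoc, ← Polynomial.C_mul, inv_mul_cancel₀ hi]
      simp
    rw [this]
    rfl
  have := ringKrullDim_le_of_surjective
    (Ideal.Quotient.lift (vanishingIdeal ℂ W) ψ.toRingHom hψ)
    (Ideal.Quotient.lift_surjective_of_surjective _ hψ hsurj)
  rw [Polynomial.ringKrullDim_of_isNoetherianRing, ringKrullDim_eq_zero_of_field, zero_add] at this
  exact this

lemma dim_le_zero_of_subset {S : Set (Fin d → ℂ)} (h : S ⊆ {0}) : dim S ≤ 0 := by
  refine (dim_mono h).trans ?_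
  have : (vanishingIdeal ℂ {(0 : Fin d → ℂ)}).IsMaximal :=
    isMaximal_iff_eq_vanishingIdeal_singleton.2 ⟨0, rfl⟩
  exact (ringKrullDim_eq_zero_of_isField ((Ideal.Quotient.maximal_ideal_iff_isField_quotient _).1 this)).le

variable (L : (Fin d → ℂ) →ₗ[ℂ] (Fin d → ℂ) →ₗ[ℂ] ℂ)

/-- A suitable point of an irreducible set that is not contained in any of the hyperplanes
`L(·, x) = 0`, `x ∈ W \ {0}`, cuts the dimension of `W` down by one. -/
lemma exists_dim_inter_le (hW : IsAlgebraicSet W) {n : ℕ} (hn : dim W ≤ (n + 1 : ℕ))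
    {S : Set (Fin d → ℂ)} (hS : (vanishingIdeal ℂ S).IsPrime)
    (hL : ∀ x ∈ W, x ≠ 0 → ∃ a ∈ S, L a x ≠ 0) :
    ∃ a ∈ S, dim (W ∩ {x | L a x = 0}) ≤ n := by
  obtain ⟨N, D, hD, rfl⟩ := hW.exists_iUnion_eq
  have hex : ∃ a ∈ S, ∀ i, D i ⊆ {0} ∨ ∃ x ∈ D i, L a x ≠ 0 := by
    -- One polynomial in `a` per component of `W`. As `S` is irreducible, their product does not
    -- vanish on it, so one `a` serves all components.
    have hq : ∀ i, ∃ q : MvPolynomial (Fin d) ℂ, q ∉ vanishingIdeal ℂ S ∧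
        ∀ a, eval a q ≠ 0 → D i ⊆ {0} ∨ ∃ x ∈ D i, L a x ≠ 0 := by
      intro i
      by_cases h : D i ⊆ {0}
      · exact ⟨1, (Ideal.ne_top_iff_one _).1 hS.ne_top, fun _ _ => Or.inl h⟩
      · obtain ⟨x, hx, hx0⟩ := Set.not_subset.1 h
        obtain ⟨a, ha, hax⟩ := hL x (Set.mem_iUnion.2 ⟨i, hx⟩) hx0
        refine ⟨linearForm (L.flip x), fun h => hax ?_, fun a ha => Or.inr ⟨x, hx, ?_⟩⟩
        · simpa [aeval_eq_eval, eval_linearForm] using h a ha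
        · simpa [eval_linearForm] using ha
    choose q hqS hq using hq
    have hprod : ∏ i, q i ∉ vanishingIdeal ℂ S := by
      rw [Ideal.IsPrime.prod_mem_iff]
      simpa using hqS
    simp only [mem_vanishingIdeal_iff, not_forall, aeval_eq_eval, map_prod] at hprod
    obtain ⟨a, ha, hprod⟩ := hprod
    exact ⟨a, ha, fun i => hq i a (Finset.prod_ne_zero_iff.1 hprod i (Finset.mem_univ _))⟩
  obtain ⟨a, ha, hD'⟩ := hex
  refine ⟨a, ha, ?_⟩
  rw [Set.iUnion_inter]
  refine dim_iUnion_le fun i => ?_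
  rcases hD' i with h | ⟨x, hx, hax⟩
  -- A component inside `{0}` need not shrink when cut, but dimension at most `0` suffices.
  · exact (dim_le_zero_of_subset (Set.inter_subset_left.trans h)).trans (by exact_mod_cast n.zero_le)
  · have h1 : dim (D i ∩ {x | L a x = 0}) + 1 ≤ dim (D i) := by
      refine dim_add_one_le (hD i) Set.inter_subset_left (f := linearForm (L a)) ?_ ?_
      · intro y hy
        simpa [aeval_eq_eval, eval_linearForm] using hy.2
      · intro h
        exact hax (by simpa [aeval_eq_eval, eval_linearForm] using h x hx)
    have h2 := (h1.trans (dim_mono (Set.subset_iUnion D i))).trans hn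
    rcases (D i ∩ {x | L a x = 0}).eq_empty_or_nonempty with h0 | h0
    · rw [h0, dim_empty]; exact bot_le
    · obtain ⟨s, hs⟩ := exists_dim_eq_natCast h0
      rw [hs] at h2 ⊢
      norm_cast at h2 ⊢
      omega

lemma IsHomogeneousAlgebraicSet.inter_ker (hW : IsHomogeneousAlgebraicSet W)
    (ℓ : (Fin d → ℂ) →ₗ[ℂ] ℂ) : IsHomogeneousAlgebraicSet (W ∩ {x | ℓ x = 0}) := by
  classical
  obtain ⟨P, hP, rfl⟩ := hW
  refine ⟨insert (linearForm ℓ) P, ?_, ?_⟩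
  · intro p hp
    rcases Finset.mem_insert.1 hp with rfl | hp
    · exact ⟨1, isHomogeneous_linearForm ℓ⟩
    · exact hP p hp
  · ext x
    simp [eval_linearForm, and_comm]

/-- If `dim W ≤ m` then `m` irreducible sets that are not contained in any of the hyperplanes
`L(·, x) = 0`, `x ∈ W \ {0}`, contain points for which the sampling map is injective at `0`. -/
lemma exists_sample_points {m : ℕ} (W : Set (Fin d → ℂ)) (hW : IsHomogeneousAlgebraicSet W)
    (hm : dim W ≤ (m : WithBot ℕ∞)) (S : Fin m → Set (Fin d → ℂ))
    (hS : ∀ j, (vanishingIdeal ℂ (S j)).IsPrime)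
    (hL : ∀ j, ∀ x ∈ W, x ≠ 0 → ∃ a ∈ S j, L a x ≠ 0) :
    ∃ a : Fin m → Fin d → ℂ, (∀ j, a j ∈ S j) ∧ ∀ x ∈ W, (∀ j, L (a j) x = 0) → x = 0 := by
  induction m generalizing W with
  | zero =>
    refine ⟨fun j => j.elim0, fun j => j.elim0, fun x hx _ => ?_⟩
    by_contra h
    exact absurd ((hW.one_le_dim hx h).trans hm) (by norm_num)
  | succ m ih =>
    obtain ⟨a₀, ha₀, hdim⟩ := exists_dim_inter_le L hW.isAlgebraicSet hm (hS 0) (hL 0)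
    obtain ⟨a, ha, hgood⟩ := ih (W ∩ {x | L a₀ x = 0}) (hW.inter_ker _) hdim (fun j => S j.succ)
      (fun j => hS _) (fun j x hx => hL _ x hx.1)
    refine ⟨Fin.cons a₀ a, Fin.cases ha₀ ha, fun x hx h => hgood x ⟨hx, h 0⟩ fun j => ?_⟩
    simpa using h j.succ

end Cone

/-! ### Openness of the injectivity condition -/

section Elimination

variable {m d : ℕ}

section

attribute [local instance] MvPolynomial.gradedAlgebra

/-- The homogeneous components of an element of an ideal generated by homogeneous polynomials
vanish at the common zeros of these. -/
lemma eval_homogeneousComponent_eq_zero {S : Set (MvPolynomial (Fin d) ℂ)}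
    (hS : ∀ p ∈ S, ∃ n : ℕ, p.IsHomogeneous n) {x : Fin d → ℂ} (hx : ∀ p ∈ S, eval x p = 0)
    {h : MvPolynomial (Fin d) ℂ} (hh : h ∈ Ideal.span S) (N : ℕ) :
    eval x (homogeneousComponent N h) = 0 := by
  have h1 : homogeneousComponent N h ∈ Ideal.span S :=
    homogeneousComponent_mem_of_mem (Ideal.homogeneous_span _ S fun p hp => hS p hp) hh N
  have h2 : Ideal.span S ≤ RingHom.ker (eval x) := Ideal.span_le.2 fun p hp => hx p hp
  exact h2 h1

end

lemma eval_eq_sum_finsuppAntidiag {q : MvPolynomial (Fin d) ℂ} {N : ℕ} (hq : q.IsHomogeneous N)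
    (x : Fin d → ℂ) :
    eval x q = ∑ ν : Finset.univ.finsuppAntidiag N, coeff ν.1 q * ∏ i, x i ^ ν.1 i := by
  rw [eval_eq', Finset.sum_coe_sort (Finset.univ.finsuppAntidiag N)
    fun ν => coeff ν q * ∏ i, x i ^ ν i]
  refine Finset.sum_subset (fun ν hν => ?_) fun ν _ hν => ?_
  · rw [Finset.mem_finsuppAntidiag]
    refine ⟨?_, Finset.subset_univ _⟩
    have := hq (mem_support_iff.1 hν)
    rwa [Finsupp.weight_apply, Finsupp.sum_fintype _ _ (by simp), Finset.sum_congr rfl] at this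
    simp
  · rw [notMem_support_iff.1 hν, zero_mul]

/-- Linearity in `a` is what makes the elimination matrix below polynomial in `A`. -/
lemma linearForm_eq_sum (L : (Fin d → ℂ) →ₗ[ℂ] (Fin d → ℂ) →ₗ[ℂ] ℂ) (a : Fin d → ℂ) :
    linearForm (L a) = ∑ i, C (a i) * linearForm (L (Pi.single i 1)) := by
  refine MvPolynomial.funext fun x => ?_
  simp only [map_sum, map_mul, eval_C, eval_linearForm]
  have := eval_linearForm (L.flip x) a
  simp only [linearForm, map_sum, map_mul, eval_C, eval_X, LinearMap.flip_apply] at this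
  rw [← this]
  exact Finset.sum_congr rfl fun i _ => mul_comm _ _

/-- Elimination: injectivity at `0` of the sampling map on a homogeneous algebraic set is a
Zariski open condition. -/
lemma exists_eval_ne_zero (L : (Fin d → ℂ) →ₗ[ℂ] (Fin d → ℂ) →ₗ[ℂ] ℂ)
    {W : Set (Fin d → ℂ)} (hW : IsHomogeneousAlgebraicSet W) (A₀ : Fin m × Fin d → ℂ)
    (hA₀ : ∀ x ∈ W, sample L A₀ x = 0 → x = 0) :
    ∃ f : MvPolynomial (Fin m × Fin d) ℂ, eval A₀ f ≠ 0 ∧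
      ∀ A, eval A f ≠ 0 → ∀ x ∈ W, sample L A x = 0 → x = 0 := by
  obtain ⟨P, hP, rfl⟩ := hW
  let J : Ideal (MvPolynomial (Fin d) ℂ) :=
    Ideal.span P ⊔ Ideal.span (Set.range fun j => linearForm (L fun i => A₀ (j, i)))
  -- Nullstellensatz: the equations at `A₀` have no common zero but possibly `0`, so `J` contains
  -- all monomials of some degree `N`.
  have hJ : idealOfVars (Fin d) ℂ ≤ J.radical := by
    rw [← vanishingIdeal_zeroLocus_eq_radical (K := ℂ), idealOfVars, Ideal.span_le]
    rintro _ ⟨i, rfl⟩ x hx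
    have hx0 : x = 0 := by
      refine hA₀ x (fun p hp => ?_) (funext fun j => ?_)
      · simpa [aeval_eq_eval] using hx p (Ideal.mem_sup_left (Ideal.subset_span hp))
      · simpa [aeval_eq_eval, eval_linearForm, sample] using
          hx _ (Ideal.mem_sup_right (Ideal.subset_span ⟨j, rfl⟩))
    simp [hx0]
  obtain ⟨N, hN⟩ := J.exists_radical_pow_le_of_fg (IsNoetherian.noetherian _)
  have hN' : idealOfVars (Fin d) ℂ ^ N ≤ J := (Ideal.pow_right_mono hJ N).trans hN
  let M := (Finset.univ : Finset (Fin d)).finsuppAntidiag N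
  have hM : ∀ μ ∈ M, Finsupp.degree μ = N := fun μ hμ => by
    rw [Finsupp.degree_eq_sum]
    exact (Finset.mem_finsuppAntidiag.1 hμ).1
  have hex : ∀ μ : M, ∃ h ∈ Ideal.span (P : Set (MvPolynomial (Fin d) ℂ)),
      ∃ e : Fin m → MvPolynomial (Fin d) ℂ,
        monomial μ.1 1 = h + ∑ j, e j * linearForm (L fun i => A₀ (j, i)) := by
    intro μ
    have h1 : monomial μ.1 (1 : ℂ) ∈ J :=
      hN' ((monomial_mem_pow_idealOfVars_iff N μ.1 one_ne_zero).2 (hM _ μ.2).ge)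
    obtain ⟨h, hh, g, hg, hsum⟩ := Submodule.mem_sup.1 h1
    obtain ⟨e, rfl⟩ := Ideal.mem_span_range_iff_exists_fun.1 hg
    exact ⟨h, hh, e, hsum.symm⟩
  choose h hh e he using hex
  -- Degree `N` parts involve only the monomials indexed by `M`, so the relations become a square
  -- linear system.
  let q : M → Fin m → Fin d → MvPolynomial (Fin d) ℂ := fun μ j i =>
    homogeneousComponent N (e μ j * linearForm (L (Pi.single i 1)))
  have hq : ∀ μ j (a : Fin d → ℂ) (x : Fin d → ℂ),
      eval x (homogeneousComponent N (e μ j * linearForm (L a))) =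
        ∑ i, a i * eval x (q μ j i) := by
    intro μ j a x
    rw [linearForm_eq_sum, Finset.mul_sum, map_sum, map_sum]
    refine Finset.sum_congr rfl fun i _ => ?_
    rw [mul_left_comm, homogeneousComponent_C_mul, map_mul, eval_C]
  -- If `x ∈ W` and `L_A(x) = 0`, subtracting the vanishing forms at `A` from the relations at `A₀`
  -- gives `v = c(A) v`, where `v` lists the degree `N` monomials at `x`. So `v = 0` wherever `det
  -- (1 - c)` is nonzero, and at `A₀` it equals `1` since `c(A₀) = 0`.
  let c : Matrix M M (MvPolynomial (Fin m × Fin d) ℂ) := fun μ ν =>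
    ∑ j, ∑ i, (C (A₀ (j, i)) - X (j, i)) * C (coeff ν.1 (q μ j i))
  have hdet : ∀ A, eval A (1 - c).det = (1 - (eval A).mapMatrix c).det := by
    intro A
    rw [RingHom.map_det, map_sub, map_one]
  have hc : ∀ A μ ν, (eval A).mapMatrix c μ ν =
      ∑ j, ∑ i, (A₀ (j, i) - A (j, i)) * coeff ν.1 (q μ j i) := by
    intro A μ ν
    change eval A (c μ ν) = _
    simp only [c, map_sum, map_mul, map_sub, eval_C, eval_X]
  refine ⟨(1 - c).det, ?_, ?_⟩
  · have h0 : (eval A₀).mapMatrix c = 0 := by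
      ext μ ν
      rw [hc]
      simp
    rw [hdet, h0, sub_zero, Matrix.det_one]
    exact one_ne_zero
  · intro A hA x hx hLx
    rw [hdet] at hA
    let v : M → ℂ := fun μ => ∏ i, x i ^ μ.1 i
    have hv : v = 0 := by
      refine Matrix.eq_zero_of_mulVec_eq_zero hA ?_
      rw [Matrix.sub_mulVec, Matrix.one_mulVec, sub_eq_zero]
      funext μ
      have h1 : v μ = ∑ j, ∑ i, A₀ (j, i) * eval x (q μ j i) := by
        have h2 : homogeneousComponent N (monomial μ.1 (1 : ℂ)) = monomial μ.1 1 :=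
          homogeneousComponent_eq_self (isHomogeneous_monomial _ (hM _ μ.2))
        have h3 : v μ = eval x (monomial μ.1 (1 : ℂ)) := by
          rw [eval_monomial, one_mul, Finsupp.prod_fintype _ _ (by simp)]
        rw [h3, ← h2, he μ, map_add, map_add, eval_homogeneousComponent_eq_zero hP hx (hh μ) N,
          zero_add, map_sum, map_sum]
        exact Finset.sum_congr rfl fun j _ => hq μ j _ x
      have h4 : ∀ j, ∑ i, A (j, i) * eval x (q μ j i) = 0 := by
        intro j
        rw [← hq μ j (fun i => A (j, i)) x]
        refine eval_homogeneousComponent_eq_zero (S := {linearForm (L fun i => A (j, i))})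
          ?_ ?_ (Ideal.mul_mem_left _ _ (Ideal.subset_span rfl)) N
        · rintro p rfl
          exact ⟨1, isHomogeneous_linearForm _⟩
        · rintro p rfl
          rw [eval_linearForm]
          exact congrFun hLx j
      have h5 : v μ = ∑ j, ∑ i, (A₀ (j, i) - A (j, i)) * eval x (q μ j i) := by
        simp only [sub_mul, Finset.sum_sub_distrib, h4, h1, sub_zero]
      rw [h5, Matrix.mulVec, dotProduct]
      simp only [hc, Finset.sum_mul]
      conv_rhs => rw [Finset.sum_comm]
      refine Finset.sum_congr rfl fun j _ => ?_
      conv_rhs => rw [Finset.sum_comm]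
      refine Finset.sum_congr rfl fun i _ => ?_
      rw [eval_eq_sum_finsuppAntidiag (homogeneousComponent_isHomogeneous N _) x, Finset.mul_sum]
      exact Finset.sum_congr rfl fun ν _ => (mul_assoc _ _ _).symm
    funext i
    -- The pure power `x i ^ N` is an entry of `v`. For `N = 0` this entry is `1`, and its vanishing
    -- is absurd.
    have hμ : Finsupp.single i N ∈ M := by
      simp [M, Finset.mem_finsuppAntidiag, Finsupp.single_apply]
    have h6 := congrFun hv ⟨_, hμ⟩
    have h7 : v ⟨_, hμ⟩ = x i ^ N := by
      simp only [v]
      rw [Finset.prod_eq_single i] <;> simp +contextual [eq_comm]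
    rw [h7] at h6
    exact eq_zero_of_pow_eq_zero h6

end Elimination

/-! ### Real points of complex algebraic sets -/

section Real

variable {σ : Type*}

/-- A complex polynomial is a combination of its real and imaginary parts. -/
lemma exists_eq_map_add_map (p : MvPolynomial σ ℂ) : ∃ a b : MvPolynomial σ ℝ,
    p = map Complex.ofRealHom a + C Complex.I * map Complex.ofRealHom b := by
  induction p using MvPolynomial.induction_on with
  | C c =>
    refine ⟨C c.re, C c.im, ?_⟩
    rw [map_C, map_C, ← C_mul, ← C_add]
    congr 1
    simp [mul_comm Complex.I]
  | add p q hp hq =>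
    obtain ⟨a, b, rfl⟩ := hp
    obtain ⟨a', b', rfl⟩ := hq
    exact ⟨a + a', b + b', by simp only [map_add]; ring⟩
  | mul_X p i hp =>
    obtain ⟨a, b, rfl⟩ := hp
    exact ⟨a * X i, b * X i, by simp only [map_mul, map_X]; ring⟩

lemma eval_map_ofReal (x : σ → ℝ) (p : MvPolynomial σ ℝ) :
    eval (fun i => (x i : ℂ)) (map Complex.ofRealHom p) = (eval x p : ℝ) := by
  rw [eval_map]
  exact (eval₂_comp_left Complex.ofRealHom (RingHom.id ℝ) x p).symm

/-- The real points of a complex algebraic set form a real algebraic set. -/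
lemma IsAlgebraicSet.realPoints {S : Set (σ → ℂ)} (hS : IsAlgebraicSet S) :
    IsAlgebraicSet (realPoints S) := by
  classical
  obtain ⟨P, rfl⟩ := hS
  choose a b hab using exists_eq_map_add_map (σ := σ)
  refine ⟨P.image a ∪ P.image b, ?_⟩
  ext x
  have key : ∀ p, eval (fun i => (x i : ℂ)) p = 0 ↔ eval x (a p) = 0 ∧ eval x (b p) = 0 := by
    intro p
    conv_lhs => rw [hab p]
    rw [map_add, map_mul, eval_C, eval_map_ofReal, eval_map_ofReal, Complex.ext_iff]
    simp
  simp only [OptimalSampling.realPoints, Set.mem_ofPred_eq, key, Finset.mem_union,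
    Finset.mem_image]
  constructor
  · rintro h _ (⟨p, hp, rfl⟩ | ⟨p, hp, rfl⟩)
    exacts [(h p hp).1, (h p hp).2]
  · exact fun h p hp => ⟨h _ (Or.inl ⟨p, hp, rfl⟩), h _ (Or.inr ⟨p, hp, rfl⟩)⟩

/-- The real dimension of the real points is at most the complex dimension. -/
lemma dim_realPoints_le (S : Set (σ → ℂ)) : dim (realPoints S) ≤ dim S := by
  -- Over `ℂ`, the functions on `T` are the real ones with `I` adjoined, an integral extension, so
  -- the two dimensions agree.
  let T : Set (σ → ℂ) := (fun x i => (x i : ℂ)) '' realPoints S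
  have hT : T ⊆ S := by
    rintro _ ⟨x, hx, rfl⟩
    exact hx
  refine le_trans (le_of_eq ?_) (dim_mono hT)
  have hmem : ∀ p, map Complex.ofRealHom p ∈ vanishingIdeal ℂ T ↔
      p ∈ vanishingIdeal ℝ (realPoints S) := by
    intro p
    simp only [mem_vanishingIdeal_iff, T, Set.forall_mem_image, aeval_eq_eval, eval_map_ofReal,
      Complex.ofReal_eq_zero]
  let γ := Ideal.quotientMap (vanishingIdeal ℂ T) (map (σ := σ) Complex.ofRealHom)
    (I := vanishingIdeal ℝ (realPoints S)) fun p hp => (hmem p).2 hp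
  refine ringKrullDim_eq_of_isIntegral γ ?_ ?_
  · intro q
    obtain ⟨p, rfl⟩ := Ideal.Quotient.mk_surjective q
    obtain ⟨a, b, rfl⟩ := exists_eq_map_add_map p
    have hmap : ∀ a, Ideal.Quotient.mk (vanishingIdeal ℂ T) (map Complex.ofRealHom a) =
        γ (Ideal.Quotient.mk _ a) := fun a => rfl
    rw [map_add, map_mul, hmap, hmap]
    refine (RingHom.isIntegralElem_map _).add _ (RingHom.IsIntegralElem.mul _ ?_
      (RingHom.isIntegralElem_map _))
    refine ⟨Polynomial.X ^ 2 + Polynomial.C 1, Polynomial.monic_X_pow_add_C _ two_ne_zero, ?_⟩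
    rw [Polynomial.eval₂_add, Polynomial.eval₂_pow, Polynomial.eval₂_X, Polynomial.eval₂_C,
      map_one, ← map_pow, ← C_pow, Complex.I_sq]
    simp
  · rw [injective_iff_map_eq_zero]
    intro q hq
    obtain ⟨p, rfl⟩ := Ideal.Quotient.mk_surjective q
    rw [Ideal.Quotient.eq_zero_iff_mem, ← hmem]
    exact Ideal.Quotient.eq_zero_iff_mem.1 hq

end Real

/-! ### The exceptional set -/

section Main

variable {m d : ℕ}

lemma IsAlgebraicSet.inter {k σ : Type*} [Field k] {S T : Set (σ → k)} (hS : IsAlgebraicSet S)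
    (hT : IsAlgebraicSet T) : IsAlgebraicSet (S ∩ T) := by
  classical
  obtain ⟨P, rfl⟩ := hS
  obtain ⟨Q, rfl⟩ := hT
  refine ⟨P ∪ Q, ?_⟩
  ext x
  simp only [Set.mem_inter_iff, Set.mem_ofPred_eq, Finset.mem_union, or_imp, forall_and]

lemma isAlgebraicSet_productSet {V : Fin m → Set (Fin d → ℂ)} (hV : ∀ j, IsAlgebraicSet (V j)) :
    IsAlgebraicSet (productSet V) := by
  classical
  choose P hP using hV
  refine ⟨Finset.univ.biUnion fun j => (P j).image (rename (Prod.mk j)), ?_⟩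
  ext A
  simp only [productSet, Set.mem_ofPred_eq, hP, Finset.mem_biUnion, Finset.mem_univ, true_and,
    Finset.mem_image]
  constructor
  · rintro h _ ⟨j, p, hp, rfl⟩
    rw [eval_rename]
    exact h j p hp
  · intro h j p hp
    have := h _ ⟨j, p, hp, rfl⟩
    rwa [eval_rename] at this

/-- A product of subsets of full dimension has factors of full dimension. -/
lemma dim_eq_of_dim_productSet_eq {S V : Fin m → Set (Fin d → ℂ)} (hS : ∀ j, (S j).Nonempty)
    (hSV : ∀ j, S j ⊆ V j) (h : dim (productSet S) = dim (productSet V)) (j : Fin m) :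
    dim (S j) = dim (V j) := by
  have hV : ∀ j, (V j).Nonempty := fun j => (hS j).mono (hSV j)
  choose s hs using fun j => exists_dim_eq_natCast (hS j)
  choose v hv using fun j => exists_dim_eq_natCast (hV j)
  rw [dim_productSet hS s hs, dim_productSet hV v hv] at h
  have hsum : ∑ j, s j = ∑ j, v j := by exact_mod_cast h
  have hle : ∀ j ∈ Finset.univ, s j ≤ v j := by
    intro j _
    have := dim_mono (hSV j)
    rw [hs, hv] at this
    exact_mod_cast this
  rw [hs, hv, (Finset.sum_eq_sum_iff_of_le hle).1 hsum j (Finset.mem_univ j)]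

/-- The `A ∈ V` for which the sampling map is not injective at `0` on `W` lie in an algebraic
subset of smaller dimension. -/
theorem exists_exceptional_set (L : (Fin d → ℂ) →ₗ[ℂ] (Fin d → ℂ) →ₗ[ℂ] ℂ)
    {W : Set (Fin d → ℂ)} (hW : IsHomogeneousAlgebraicSet W) {V : Fin m → Set (Fin d → ℂ)}
    (hV : ∀ j, IsAlgebraicSet (V j)) (hVne : ∀ j, (V j).Nonempty)
    (hadm : ∀ j, IsAdmissible (V j) {ℓ | ∃ x ∈ W \ {0}, ℓ = L.flip x})
    (hm : dim W ≤ (m : WithBot ℕ∞)) :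
    ∃ Z : Set (Fin m × Fin d → ℂ), IsAlgebraicSet Z ∧ Z ⊆ productSet V ∧
      dim Z < dim (productSet V) ∧
      ∀ A ∈ productSet V \ Z, ∀ x ∈ W, sample L A x = 0 → x = 0 := by
  classical
  choose n D hD hVD using fun j => (hV j).exists_iUnion_eq
  let K : (∀ j, Fin (n j)) → Set (Fin m × Fin d → ℂ) := fun c => productSet fun j => D j (c j)
  have hsub : ∀ j i, D j i ⊆ V j := fun j i => by
    rw [hVD j]
    exact Set.subset_iUnion (D j) i
  have hKV : ∀ c, K c ⊆ productSet V := fun c A hA j => hsub j _ (hA j)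
  have hVK : productSet V = ⋃ c, K c := by
    refine Set.Subset.antisymm (fun A hA => ?_) (Set.iUnion_subset hKV)
    have h : ∀ j, ∃ i, (fun l => A (j, l)) ∈ D j i := fun j => by
      have := hA j
      rw [hVD j] at this
      exact Set.mem_iUnion.1 this
    choose c hc using h
    exact Set.mem_iUnion.2 ⟨c, hc⟩
  have hf : ∀ c, ∃ f : MvPolynomial (Fin m × Fin d) ℂ,
      (∀ A, eval A f ≠ 0 → ∀ x ∈ W, sample L A x = 0 → x = 0) ∧
      (dim (K c) = dim (productSet V) → f ∉ vanishingIdeal ℂ (K c)) := by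
    intro c
    by_cases hdim : dim (K c) = dim (productSet V)
    · have hdimj := dim_eq_of_dim_productSet_eq (fun j => nonempty_of_isPrime (hD j (c j)))
        (fun j => hsub j _) hdim
      obtain ⟨a, ha, hgood⟩ := exists_sample_points L W hW hm (fun j => D j (c j))
        (fun j => hD j _) (by
          intro j x hx hx0
          -- Otherwise a hyperplane section of `V j` would contain a component of full dimension.
          by_contra! hcon
          have h1 := hadm j (L.flip x) ⟨x, ⟨hx, hx0⟩, rfl⟩
          have h2 : D j (c j) ⊆ V j ∩ {a | L.flip x a = 0} :=
            fun a ha => ⟨hsub j _ ha, hcon a ha⟩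
          exact absurd (dim_mono h2) (not_le.2 (by rwa [hdimj j])))
      obtain ⟨f, hf0, hf⟩ := exists_eval_ne_zero L hW (fun p => a p.1 p.2)
        fun x hx h => hgood x hx fun j => congrFun h j
      refine ⟨f, hf, fun _ h => hf0 ?_⟩
      simpa [aeval_eq_eval] using h (fun p => a p.1 p.2) ha
    -- A piece of smaller dimension needs no cutting, and `0` meets the first condition vacuously.
    · exact ⟨0, fun A h => absurd (map_zero _) h, fun h => absurd h hdim⟩
  choose f hfgood hfK using hf
  -- A single nonvanishing `f c` makes `A` good, whichever piece contains `A`, so only common zeros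
  -- of all `f c` have to be excluded.
  let F : Set (Fin m × Fin d → ℂ) := {A | ∀ c, eval A (f c) = 0}
  have hF : IsAlgebraicSet F := by
    refine ⟨Finset.univ.image f, ?_⟩
    ext A
    simp [F]
  refine ⟨productSet V ∩ F, (isAlgebraicSet_productSet hV).inter hF, Set.inter_subset_left, ?_, ?_⟩
  · have hne : Nonempty (∀ j, Fin (n j)) := by
      obtain ⟨A, hA⟩ := productSet_nonempty hVne
      rw [hVK] at hA
      obtain ⟨c, -⟩ := Set.mem_iUnion.1 hA
      exact ⟨c⟩
    obtain ⟨c, hc⟩ := exists_dim_iUnion_le fun c => K c ∩ F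
    rw [← Set.iUnion_inter, ← hVK] at hc
    refine hc.trans_lt ?_
    by_cases hdim : dim (K c) = dim (productSet V)
    · rw [← hdim]
      have hprime : (vanishingIdeal ℂ (K c)).IsPrime :=
        isPrime_vanishingIdeal_productSet fun j => hD j _
      refine dim_lt_of_add_one_le (nonempty_of_isPrime hprime)
        (dim_add_one_le hprime Set.inter_subset_left (f := f c) ?_ (hfK c hdim))
      intro A hA
      simpa [aeval_eq_eval] using hA.2 c
    · exact (dim_mono Set.inter_subset_left).trans_lt (lt_of_le_of_ne (dim_mono (hKV c)) hdim)
  · rintro A ⟨hAV, hAZ⟩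
    have : A ∉ F := fun h => hAZ ⟨hAV, h⟩
    obtain ⟨c, hc⟩ := not_forall.1 this
    exact hfgood c A hc

end Main

end OptimalSampling

end

theorem mainTheorem2 {d m : ℕ}
    (L : (Fin d → ℂ) →ₗ[ℂ] (Fin d → ℂ) →ₗ[ℂ] ℂ)
    (W : Set (Fin d → ℂ)) (hW : OptimalSampling.IsHomogeneousAlgebraicSet W)
    (V : Fin m → Set (Fin d → ℂ))
    (hV : ∀ j, OptimalSampling.IsAlgebraicSet (V j))
    (hVne : ∀ j, (V j).Nonempty)
    (hadm : ∀ j, OptimalSampling.IsAdmissible (V j)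
      {ℓ | ∃ x ∈ W \ {0}, ℓ = L.flip x})
    (hreal : OptimalSampling.dim
        (OptimalSampling.realPoints (OptimalSampling.productSet V)) =
      OptimalSampling.dim (OptimalSampling.productSet V))
    (hm : OptimalSampling.dim W ≤ (m : WithBot ℕ∞)) :
    ∃ Z : Set (Fin m × Fin d → ℝ),
      OptimalSampling.IsAlgebraicSet Z ∧
      Z ⊆ OptimalSampling.realPoints (OptimalSampling.productSet V) ∧
      OptimalSampling.dim Z <
        OptimalSampling.dim (OptimalSampling.realPoints (OptimalSampling.productSet V)) ∧
      ∀ A ∈ OptimalSampling.realPoints (OptimalSampling.productSet V) \ Z,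
        ∀ x ∈ W, OptimalSampling.sample L (fun p => (A p : ℂ)) x = 0 → x = 0 := by
  obtain ⟨Z, hZ, hZV, hdim, hgood⟩ :=
    OptimalSampling.exists_exceptional_set L hW hV hVne hadm hm
  refine ⟨OptimalSampling.realPoints Z, hZ.realPoints, fun A hA => hZV hA, ?_, ?_⟩
  · rw [hreal]
    exact (OptimalSampling.dim_realPoints_le Z).trans_lt hdim
  · rintro A ⟨hAV, hAZ⟩
    exact hgood (fun p => (A p : ℂ)) ⟨hAV, hAZ⟩
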